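/- Let $X$ and $Y$ be metric spaces of bounded geometry, let $n$ be a natural number, and let $f:X\to Y$ be a coarsely $n$-to-1, coarsely surjective function. If $X$ has Yu's Property A, then $Y$ has Property A. Here the notions are as follows. - A metric space $X$ has *bounded geometry* if there are a subset $\Gamma\subseteq X$ and a number $r$ such that every point of $X$ is at distance at most $r$ from some point of $\Gamma$, and for every $R$ there is $N\in\mathbb N$ such that every closed ball of radius $R$ in $X$ contains at most $N$ points of $\Gamma$. (In particular this holds, with $\Gamma=X$, for a discrete space in which the number of points in a ball of radius $R$ is bounded by a constant depending only on $R$.) - A function $f:X\to Y$ is *bornologous* if there is a function $E:[0,\infty)\to[0,\infty)$ such that $\operatorname{diam}(f(A))\le E(r)$ for every $r\ge 0$ and every $A\subseteq X$ with $\operatorname{diam}(A)\le r$. - A function $f:X\to Y$ is *coarsely $n$-to-1* if it is bornologous and there is a function $C:[0,\infty)\to[0,\infty)$ such that for every $r\ge 0$ and every $B\subseteq Y$ with $\operatorname{diam}(B)\le r$ one has $f^{-1}(B)=\bigcup_{i=1}^n A_i$ for some subsets $A_i\subseteq X$ with $\operatorname{diam}(A_i)<C(r)$ for $i=1,\dots,n$.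 - A function $f:X\to Y$ is *coarsely surjective* if there is $R>0$ such that every point of $Y$ is at distance less than $R$ from some point of $f(X)$. - A metric space $X$ has *Property A* if for all $R>0$ and $\varepsilon>0$ there is a family $(A_x)_{x\in X}$ of finite subsets of $X\times\mathbb N$ such that (1) $(x,1)\in A_x$ for all $x\in X$; (2) $A_x\cap A_y\neq\emptyset$ and $\dfrac{\#(A_x\,\triangle\, A_y)}{\#(A_x\cap A_y)}<\varepsilon$ for all $x,y\in X$ with $d(x,y)\le R$; (3) there is $S>0$ such that $d(y,z)\le S$ whenever $(y,k),(z,m)\in A_x$ for some $x\in X$. -/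

import Mathlib

/-- A function of metric spaces is bornologous if there is `C : [0,∞) → [0,∞)` such that the image
of every `r`-bounded set is `C r`-bounded. Extended diameters are used, so that an unbounded set
has diameter `∞`. -/
def Bornologous {X : Type*} {Y : Type*} [MetricSpace X] [MetricSpace Y] (f : X → Y) : Prop :=
  ∃ C : NNReal → NNReal, ∀ (r : NNReal) (A : Set X),
    Metric.ediam A ≤ (r : ENNReal) → Metric.ediam (f '' A) ≤ (C r : ENNReal)

/-- `f` is coarsely `n`-to-1: it is bornologous, and there is a control function `C` such that the
preimage of each set of diameter at most `r` is a union of `n` sets of diameter less than `C r`. -/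
def CoarselyNToOne {X : Type*} {Y : Type*} [MetricSpace X] [MetricSpace Y] (n : ℕ)
    (f : X → Y) : Prop :=
  Bornologous f ∧
    ∃ C : NNReal → NNReal, ∀ (r : NNReal) (B : Set Y), Metric.ediam B ≤ (r : ENNReal) →
      ∃ A : Fin n → Set X, f ⁻¹' B = ⋃ i, A i ∧ ∀ i, Metric.ediam (A i) < (C r : ENNReal)

/-- `f` is coarsely surjective: `Y` is contained in the `R`-neighbourhood of the image of `f` for
some `R > 0`. -/
def CoarselySurjective {X : Type*} {Y : Type*} [MetricSpace Y] (f : X → Y) : Prop :=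
  ∃ R : ℝ, 0 < R ∧ ∀ y : Y, ∃ x : X, dist y (f x) < R

/-- A metric space has bounded geometry if some coarsely dense subset `Γ` is uniformly locally
finite: for each `R`, the number of points of `Γ` in a ball of radius `R` is bounded independently
of the ball. (For a discrete space whose `R`-balls have at most `N R` points, take `Γ` to be the
whole space.) -/
def BoundedGeometry (X : Type*) [MetricSpace X] : Prop :=
  ∃ (Γ : Set X) (r : ℝ), (∀ x : X, ∃ g ∈ Γ, dist x g ≤ r) ∧
    ∀ R : ℝ, ∃ N : ℕ, ∀ x : X, (Γ ∩ Metric.closedBall x R).encard ≤ N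

open Classical in
/-- Yu's Property A: for all `R, ε > 0` there are finite subsets `A x` of `X × ℕ`, for `x : X`,
with `(x, 1) ∈ A x`, with `#(A x ∆ A y) / #(A x ∩ A y) < ε` whenever `dist x y ≤ R`, and such that
the projections of the `A x` to `X` are uniformly bounded. The quotient is written without
division, so that it counts as infinite when `A x ∩ A y` is empty. -/
def PropertyA (X : Type*) [MetricSpace X] : Prop :=
  ∀ R : ℝ, 0 < R → ∀ ε : ℝ, 0 < ε → ∃ A : X → Finset (X × ℕ),
    (∀ x, (x, 1) ∈ A x) ∧
    (∀ x y, dist x y ≤ R →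
      ((symmDiff (A x) (A y)).card : ℝ) < ε * ((A x ∩ A y).card : ℝ)) ∧
    ∃ S : ℝ, 0 < S ∧ ∀ x, ∀ p ∈ A x, ∀ q ∈ A x, dist p.1 q.1 ≤ S

/-!
The idea is to spread out over growing balls. Push the sets `A x` of Property A forward along `f`
to a uniformly locally finite net of `Y` and rescale them, so that every `x : X` carries a finite
set `D x` located near `f x`, of size between `L` and `2 * L`, with `D x` almost equal to `D x'`
when `x` and `x'` are close (`PropertyA.exists_normalized_family`). The rescaling is needed because
the sizes of `A x` and `A x'` are unrelated when `x` and `x'` are far apart, even if `f x = f x'`;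
rounding is harmless since the number of net points involved is uniformly bounded.

For `y : Y` let `B y k` be the union of the `D x` over the net points `x` of `X` with
`dist (f x) y ≤ r + k * R`. This preimage is covered by `n` bounded sets, on each of which the
`D x` are nearly constant, so `B y k` has between `L` and `3 * n * L` elements
(`card_biUnion_le_of_cover`). Moreover `B y k ⊆ B y' (k + 1)` when `dist y y' ≤ R`. Therefore, in
the disjoint union of the `B y k` over `k < M`, which has at least `M * L` elements, the differences
between `y` and `y'` telescope to at most `3 * n * L` elements on either side. This is negligible
for large `M` (`PropertyA.of_nested_families`).
-/

/-! ### Coarse maps in terms of distances -/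

lemma Bornologous.exists_dist_le {X Y : Type*} [MetricSpace X] [MetricSpace Y] {f : X → Y}
    (hf : Bornologous f) (r : ℝ) :
    ∃ E : ℝ, ∀ x x' : X, dist x x' ≤ r → dist (f x) (f x') ≤ E := by
  obtain ⟨C, hC⟩ := hf
  refine ⟨C r.toNNReal, fun x x' h => ?_⟩
  have h1 : Metric.ediam ({x, x'} : Set X) ≤ (r.toNNReal : ENNReal) := by
    rw [Metric.ediam_pair, edist_dist]
    exact ENNReal.ofReal_le_ofReal h
  have h2 := hC _ _ h1
  rw [Set.image_pair, Metric.ediam_pair, edist_nndist] at h2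
  exact_mod_cast h2

lemma CoarselyNToOne.exists_cover_preimage_closedBall {X Y : Type*} [MetricSpace X]
    [MetricSpace Y] {n : ℕ} {f : X → Y} (hf : CoarselyNToOne n f) (r : ℝ) :
    ∃ C : ℝ, ∀ y : Y, ∃ A : Fin n → Set X, (∀ x, dist (f x) y ≤ r → ∃ i, x ∈ A i) ∧
      ∀ i, ∀ x ∈ A i, ∀ x' ∈ A i, dist x x' ≤ C := by
  obtain ⟨-, C, hC⟩ := hf
  refine ⟨C (2 * r.toNNReal), fun y => ?_⟩
  have hball : Metric.ediam (Metric.closedBall y r) ≤ ((2 * r.toNNReal : NNReal) : ENNReal) := by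
    have h := Metric.ediam_closedEBall_le (x := y) (r := (r.toNNReal : ENNReal))
    refine le_trans (Metric.ediam_mono fun z hz => ?_) (h.trans (by simp))
    rw [Metric.mem_closedEBall, edist_dist]
    exact ENNReal.ofReal_le_ofReal hz
  obtain ⟨A, hA, hdiam⟩ := hC _ _ hball
  refine ⟨A, fun x hx => ?_, fun i x hx x' hx' => ?_⟩
  · have : x ∈ f ⁻¹' Metric.closedBall y r := hx
    rw [hA] at this
    exact Set.mem_iUnion.1 this
  · have h := (Metric.edist_le_ediam_of_mem hx hx').trans (hdiam i).le
    rw [edist_nndist] at h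
    exact_mod_cast h

/-! ### Rescaling a finite set pushed forward along a map -/

open Classical in
/-- The pushforward along `q` of the uniform probability measure on `A`, multiplied by `L` and
rounded up, encoded as its subgraph: the pairs `⟨w, m⟩` with `w ∈ q '' A` and
`m < ⌈L * #{a ∈ A | q a = w} / #A⌉`. -/
noncomputable def quantizedPushforward {α β : Type*} (q : α → β) (L : ℕ) (A : Finset α) :
    Finset (Σ _ : β, ℕ) :=
  (A.image q).sigma fun w =>
    Finset.range ⌈(L : ℝ) * ((A.filter (q · = w)).card / A.card)⌉₊

open Classical in
lemma sum_card_fiber_div_card {α β : Type*} (q : α → β) {A : Finset α} (hA : A.Nonempty) :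
    ∑ w ∈ A.image q, ((A.filter (q · = w)).card : ℝ) / A.card = 1 := by
  have h := Finset.card_eq_sum_card_image q A
  have hpos : (0 : ℝ) < A.card := by exact_mod_cast hA.card_pos
  rw [← Finset.sum_div, div_eq_one_iff_eq hpos.ne']
  exact_mod_cast h.symm

open Classical in
lemma le_card_quantizedPushforward {α β : Type*} (q : α → β) (L : ℕ) {A : Finset α}
    (hA : A.Nonempty) : L ≤ (quantizedPushforward q L A).card := by
  have h : (L : ℝ) * ∑ w ∈ A.image q, ((A.filter (q · = w)).card : ℝ) / A.card
      ≤ ((quantizedPushforward q L A).card : ℝ) := by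
    rw [quantizedPushforward, Finset.card_sigma, Finset.mul_sum]
    push_cast
    refine Finset.sum_le_sum fun w _ => ?_
    rw [Finset.card_range]
    exact Nat.le_ceil _
  rw [sum_card_fiber_div_card q hA, mul_one] at h
  exact_mod_cast h

open Classical in
lemma card_quantizedPushforward_le {α β : Type*} (q : α → β) (L : ℕ) {A : Finset α}
    (hA : A.Nonempty) : (quantizedPushforward q L A).card ≤ L + (A.image q).card := by
  have h : ((quantizedPushforward q L A).card : ℝ) ≤
      (L : ℝ) * ∑ w ∈ A.image q, ((A.filter (q · = w)).card : ℝ) / A.card + (A.image q).card := by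
    rw [quantizedPushforward, Finset.card_sigma, Finset.mul_sum, Finset.card_eq_sum_ones (A.image q)]
    push_cast
    rw [← Finset.sum_add_distrib]
    refine Finset.sum_le_sum fun w _ => ?_
    rw [Finset.card_range]
    exact (Nat.ceil_lt_add_one (by positivity)).le
  rw [sum_card_fiber_div_card q hA, mul_one] at h
  exact_mod_cast h

open Classical in
lemma card_quantizedPushforward_sdiff_le {α β : Type*} [DecidableEq α] (q : α → β) (L : ℕ) {A A' : Finset α}
    {δ : ℝ} (h : ((symmDiff A A').card : ℝ) < δ * ((A ∩ A').card : ℝ)) :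
    ((quantizedPushforward q L A \ quantizedPushforward q L A').card : ℝ)
      ≤ L * δ + (A.image q).card := by
  have hinter : (A ∩ A').Nonempty := by
    rw [Finset.nonempty_iff_ne_empty]
    intro h0
    rw [h0] at h
    have : (0 : ℝ) ≤ (symmDiff A A').card := by positivity
    simp at h
    linarith
  have hA : A.Nonempty := hinter.mono Finset.inter_subset_left
  have hpos : (0 : ℝ) < (A ∩ A').card := by exact_mod_cast hinter.card_pos
  have hposA : (0 : ℝ) < A.card := by exact_mod_cast hA.card_pos
  have hposA' : (0 : ℝ) < A'.card := by
    exact_mod_cast (hinter.mono Finset.inter_subset_right).card_pos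
  set s : ℝ := max A.card A'.card with hs
  have hspos : 0 < s := lt_max_of_lt_left hposA
  -- Comparing both measures with the uniform measure on `A ∩ A'` of total mass `#(A ∩ A') / s`
  -- bounds the positive part of their difference.
  let e : β → ℝ := fun w => (A.filter (q · = w)).card / A.card - ((A ∩ A').filter (q · = w)).card / s
  have hsum : ∑ w ∈ A.image q, e w ≤ δ := by
    have h1 : ∑ w ∈ A.image q, (((A ∩ A').filter (q · = w)).card : ℝ) = (A ∩ A').card := by
      have := Finset.card_eq_sum_card_fiberwise (f := q) (s := A ∩ A') (t := A.image q)
        (fun x hx => Finset.mem_coe.2 (Finset.mem_image_of_mem q (Finset.mem_inter.1 hx).1))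
      exact_mod_cast this.symm
    rw [Finset.sum_sub_distrib, sum_card_fiber_div_card q hA, ← Finset.sum_div, h1]
    have h2 : s ≤ (symmDiff A A').card + (A ∩ A').card := by
      have hun : A ∪ A' ⊆ symmDiff A A' ∪ (A ∩ A') := by
        intro x hx
        simp only [Finset.mem_union, Finset.mem_symmDiff, Finset.mem_inter] at hx ⊢
        tauto
      have hcard := (Finset.card_le_card hun).trans (Finset.card_union_le _ _)
      have hl := Finset.card_le_card (Finset.subset_union_left (s₁ := A) (s₂ := A'))
      have hr := Finset.card_le_card (Finset.subset_union_right (s₁ := A) (s₂ := A'))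
      exact max_le (by exact_mod_cast hl.trans hcard) (by exact_mod_cast hr.trans hcard)
    have h3 : ((A ∩ A').card : ℝ) ≤ s := le_max_of_le_left (by
      exact_mod_cast Finset.card_le_card Finset.inter_subset_left)
    have hδ : 0 ≤ δ := by
      by_contra hneg
      have : (0 : ℝ) ≤ (symmDiff A A').card := by positivity
      nlinarith
    rw [sub_le_iff_le_add, ← sub_le_iff_le_add', le_div_iff₀ hspos]
    nlinarith
  have hsub : quantizedPushforward q L A \ quantizedPushforward q L A' ⊆
      (A.image q).sigma fun w =>
        Finset.range ⌈(L : ℝ) * ((A.filter (q · = w)).card / A.card)⌉₊ \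
          Finset.range ⌈(L : ℝ) * ((A'.filter (q · = w)).card / A'.card)⌉₊ := by
    rintro ⟨w, m⟩ hwm
    simp only [quantizedPushforward, Finset.mem_sdiff, Finset.mem_sigma] at hwm ⊢
    refine ⟨hwm.1.1, hwm.1.2, fun hm => hwm.2 ⟨?_, hm⟩⟩
    by_contra hw
    -- Outside `q '' A'` the fibre is empty, so the range would be `range 0`.
    have hempty : A'.filter (q · = w) = ∅ := by
      refine Finset.filter_eq_empty_iff.2 fun a ha haw => hw ?_
      exact haw ▸ Finset.mem_image_of_mem q ha
    simp [hempty] at hm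
  have hterm : ∀ w ∈ A.image q,
      (((Finset.range ⌈(L : ℝ) * ((A.filter (q · = w)).card / A.card)⌉₊ \
          Finset.range ⌈(L : ℝ) * ((A'.filter (q · = w)).card / A'.card)⌉₊).card : ℕ) : ℝ)
        ≤ L * e w + 1 := by
    intro w _
    have hi : (((A ∩ A').filter (q · = w)).card : ℝ) ≤ (A.filter (q · = w)).card := by
      exact_mod_cast Finset.card_le_card
        (Finset.filter_subset_filter _ Finset.inter_subset_left)
    have hi' : (((A ∩ A').filter (q · = w)).card : ℝ) ≤ (A'.filter (q · = w)).card := by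
      exact_mod_cast Finset.card_le_card
        (Finset.filter_subset_filter _ Finset.inter_subset_right)
    have he : 0 ≤ e w := sub_nonneg.2
      (div_le_div₀ (by positivity) hi hposA (le_max_left _ _))
    have he' : (A.filter (q · = w)).card / A.card - (A'.filter (q · = w)).card / A'.card ≤ e w :=
      sub_le_sub_left (div_le_div₀ (by positivity) hi' hposA' (le_max_right _ _)) _
    set a : ℝ := (A.filter (q · = w)).card / A.card with ha
    set a' : ℝ := (A'.filter (q · = w)).card / A'.card with ha'
    have ha0 : 0 ≤ a := by positivity
    have hc : (Finset.range ⌈(L : ℝ) * a⌉₊ \ Finset.range ⌈(L : ℝ) * a'⌉₊).card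
        = ⌈(L : ℝ) * a⌉₊ - ⌈(L : ℝ) * a'⌉₊ := by
      rcases le_total ⌈(L : ℝ) * a'⌉₊ ⌈(L : ℝ) * a⌉₊ with hle | hle
      · rw [Finset.card_sdiff_of_subset (Finset.range_subset_range.2 hle)]
        simp
      · rw [Finset.sdiff_eq_empty_iff_subset.2 (Finset.range_subset_range.2 hle)]
        simp [Nat.sub_eq_zero_of_le hle]
    rw [hc]
    have hL : (0 : ℝ) ≤ L := by positivity
    rcases le_total ⌈(L : ℝ) * a'⌉₊ ⌈(L : ℝ) * a⌉₊ with hle | hle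
    · rw [Nat.cast_sub hle]
      have h1 := Nat.ceil_lt_add_one (mul_nonneg hL ha0)
      have h2 := Nat.le_ceil ((L : ℝ) * a')
      have h3 := mul_le_mul_of_nonneg_left he' hL
      linarith
    · rw [Nat.sub_eq_zero_of_le hle, Nat.cast_zero]
      positivity
  calc ((quantizedPushforward q L A \ quantizedPushforward q L A').card : ℝ)
      ≤ ∑ w ∈ A.image q, (L * e w + 1) := by
        refine le_trans (Nat.cast_le.2 (Finset.card_le_card hsub)) ?_
        rw [Finset.card_sigma, Nat.cast_sum]
        exact Finset.sum_le_sum hterm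
    _ = L * ∑ w ∈ A.image q, e w + (A.image q).card := by
        rw [Finset.sum_add_distrib, Finset.mul_sum]
        simp
    _ ≤ L * δ + (A.image q).card := by gcongr

open Classical in
/-- Property A of `X`, transported along a bornologous map to a space of bounded geometry, with
finite sets of comparable size. -/
lemma PropertyA.exists_normalized_family {X Y : Type*} [MetricSpace X] [MetricSpace Y]
    (hA : PropertyA X) (hY : BoundedGeometry Y) {f : X → Y} (hf : Bornologous f) (R : ℝ)
    {δ : ℝ} (hδ : 0 < δ) :
    ∃ (L : ℕ) (D : X → Finset (Σ _ : Y, ℕ)) (S : ℝ), 1 ≤ L ∧ (∀ x, L ≤ (D x).card) ∧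
      (∀ x, (D x).card ≤ 2 * L) ∧
      (∀ x x', dist x x' ≤ R → ((D x \ D x').card : ℝ) ≤ δ * L) ∧
      ∀ x, ∀ p ∈ D x, dist p.1 (f x) ≤ S := by
  obtain ⟨Γ, s, hΓ, hN⟩ := hY
  choose π hπΓ hπ using hΓ
  obtain ⟨A, hA1, hA2, S, -, hAS⟩ := hA (max R 1) (by positivity) (δ / 2) (by positivity)
  obtain ⟨E, hE⟩ := hf.exists_dist_le S
  obtain ⟨K, hK⟩ := hN (s + E)
  let q : X × ℕ → Y := fun p => π (f p.1)
  have hq : ∀ x, ∀ p ∈ A x, dist (q p) (f x) ≤ s + E := fun x p hp => by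
    have h1 := hE _ _ (hAS x p hp (x, 1) (hA1 x))
    have h2 := hπ (f p.1)
    rw [dist_comm] at h2
    exact (dist_triangle _ (f p.1) _).trans (add_le_add h2 h1)
  have hcard : ∀ x, ((A x).image q).card ≤ K := fun x => by
    have hsub : (((A x).image q : Finset Y) : Set Y) ⊆ Γ ∩ Metric.closedBall (f x) (s + E) := by
      intro w hw
      obtain ⟨p, hp, rfl⟩ := Finset.mem_image.1 (Finset.mem_coe.1 hw)
      exact ⟨hπΓ _, hq x p hp⟩
    have h := (Set.encard_le_encard hsub).trans (hK (f x))
    rw [Set.encard_coe_eq_coe_finsetCard] at h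
    exact_mod_cast h
  -- `L` dominates the rounding error `K`, also after multiplication by `δ / 2`.
  obtain ⟨L₀, hL₀⟩ := exists_nat_ge (2 * K / δ)
  obtain ⟨L, hLL₀, hLK, hL1⟩ : ∃ L, L₀ ≤ L ∧ K ≤ L ∧ 1 ≤ L :=
    ⟨max L₀ (max K 1), by simp, by simp, by simp⟩
  have hLδ : (K : ℝ) ≤ L * (δ / 2) := by
    have h1 : (L₀ : ℝ) ≤ L := by exact_mod_cast hLL₀
    have h2 := (div_le_iff₀ hδ).1 (hL₀.trans h1)
    linarith
  have hne : ∀ x, (A x).Nonempty := fun x => ⟨_, hA1 x⟩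
  refine ⟨L, fun x => quantizedPushforward q L (A x), s + E, hL1,
    fun x => le_card_quantizedPushforward q L (hne x),
    fun x => ?_, fun x x' hxx' => ?_, fun x p hp => ?_⟩
  · have := (card_quantizedPushforward_le q L (hne x)).trans
      (Nat.add_le_add_left ((hcard x).trans hLK) L)
    rwa [← two_mul] at this
  · have h := card_quantizedPushforward_sdiff_le q L (hA2 x x' (hxx'.trans (le_max_left _ _)))
    have hK' : (((A x).image q).card : ℝ) ≤ K := by exact_mod_cast hcard x
    linarith
  · obtain ⟨a, ha, hap⟩ := Finset.mem_image.1 (Finset.mem_sigma.1 hp).1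
    rw [← hap]
    exact hq x a ha

/-! ### Unions of nearly constant families -/

open Classical in
/-- If a finite index set is covered by `n` parts of at most `N` elements, and on each part the sets
`D x` differ from one another by at most `L / N` elements, then the union of all `D x` is about as
large as a union of `n` of them. -/
lemma card_biUnion_le_of_cover {X β : Type*} [DecidableEq β] {n N L : ℕ} {δ : ℝ} (hδ0 : 0 ≤ δ) (hδ : N * δ ≤ 1)
    {D : X → Finset β} (hD : ∀ x, (D x).card ≤ 2 * L) {F : Finset X} {A : Fin n → Set X}
    (hcover : ∀ x ∈ F, ∃ i, x ∈ A i) (hN : ∀ i, (F.filter (· ∈ A i)).card ≤ N)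
    (hnear : ∀ i, ∀ x ∈ A i, ∀ x' ∈ A i, ((D x \ D x').card : ℝ) ≤ δ * L) :
    (F.biUnion D).card ≤ 3 * n * L := by
  have hpart : ∀ i, ((F.filter (· ∈ A i)).biUnion D).card ≤ 3 * L := by
    intro i
    rcases (F.filter (· ∈ A i)).eq_empty_or_nonempty with h0 | ⟨x₀, hx₀⟩
    · simp [h0]
    have hx₀A := (Finset.mem_filter.1 hx₀).2
    have hsub : (F.filter (· ∈ A i)).biUnion D ⊆
        D x₀ ∪ (F.filter (· ∈ A i)).biUnion (fun x => D x \ D x₀) := by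
      intro p hp
      simp only [Finset.mem_union, Finset.mem_biUnion, Finset.mem_sdiff] at hp ⊢
      obtain ⟨x, hx, hpx⟩ := hp
      by_cases h : p ∈ D x₀
      · exact Or.inl h
      · exact Or.inr ⟨x, hx, hpx, h⟩
    have h1 : (((F.filter (· ∈ A i)).biUnion fun x => D x \ D x₀).card : ℝ) ≤ L := by
      calc (((F.filter (· ∈ A i)).biUnion fun x => D x \ D x₀).card : ℝ)
          ≤ ∑ x ∈ F.filter (· ∈ A i), ((D x \ D x₀).card : ℝ) := by
            exact_mod_cast Finset.card_biUnion_le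
        _ ≤ ∑ x ∈ F.filter (· ∈ A i), δ * L :=
            Finset.sum_le_sum fun x hx => hnear i x (Finset.mem_filter.1 hx).2 x₀ hx₀A
        _ = (F.filter (· ∈ A i)).card * δ * L := by
            rw [Finset.sum_const, nsmul_eq_mul, mul_assoc]
        _ ≤ N * δ * L := by
            have : ((F.filter (· ∈ A i)).card : ℝ) ≤ N := by exact_mod_cast hN i
            gcongr
        _ ≤ L := mul_le_of_le_one_left (by positivity) hδ
    have h2 := (Finset.card_le_card hsub).trans (Finset.card_union_le _ _)
    have h3 := hD x₀
    have h4 : ((F.filter (· ∈ A i)).biUnion fun x => D x \ D x₀).card ≤ L := by exact_mod_cast h1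
    omega
  have hsub : F.biUnion D ⊆ Finset.univ.biUnion fun i => (F.filter (· ∈ A i)).biUnion D := by
    intro p hp
    obtain ⟨x, hx, hpx⟩ := Finset.mem_biUnion.1 hp
    obtain ⟨i, hi⟩ := hcover x hx
    exact Finset.mem_biUnion.2 ⟨i, Finset.mem_univ _,
      Finset.mem_biUnion.2 ⟨x, Finset.mem_filter.2 ⟨hx, hi⟩, hpx⟩⟩
  calc (F.biUnion D).card
      ≤ ∑ i : Fin n, ((F.filter (· ∈ A i)).biUnion D).card :=
        (Finset.card_le_card hsub).trans Finset.card_biUnion_le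
    _ ≤ ∑ _i : Fin n, 3 * L := Finset.sum_le_sum fun i _ => hpart i
    _ = 3 * n * L := by simp; ring

/-! ### Property A from nested families -/

lemma card_sigma_range_sdiff_le {β : Type*} [DecidableEq β] {B B' : ℕ → Finset β} {M : ℕ}
    (hmono : ∀ k, B' k ⊆ B' (k + 1)) (h : ∀ k, B k ⊆ B' (k + 1)) :
    ((Finset.range M).sigma B \ (Finset.range M).sigma B').card ≤ (B' M).card := by
  have hsub : (Finset.range M).sigma B \ (Finset.range M).sigma B' ⊆
      (Finset.range M).sigma fun k => B' (k + 1) \ B' k := by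
    rintro ⟨k, b⟩ hb
    simp only [Finset.mem_sdiff, Finset.mem_sigma] at hb ⊢
    exact ⟨hb.1.1, h k hb.1.2, fun hb' => hb.2 ⟨hb.1.1, hb'⟩⟩
  refine (Finset.card_le_card hsub).trans ?_
  rw [Finset.card_sigma]
  have htel : ∀ m, ∑ k ∈ Finset.range m, (B' (k + 1) \ B' k).card ≤ (B' m).card := by
    intro m
    induction m with
    | zero => simp
    | succ m ih =>
      rw [Finset.sum_range_succ, Finset.card_sdiff_of_subset (hmono m)]
      have := Finset.card_le_card (hmono m)
      omega
  exact htel M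

open Classical in
/-- Suppose that for all `R` there is a constant `c` such that for each `M` every `y` carries a
sequence of finite sets `B y k` located near `y` for `k < M`, whose sizes lie between `L` and
`c * L` for `k ≤ M`, and which interleave at distance `R`. Then Property A holds. -/
lemma PropertyA.of_nested_families {Y : Type*} [MetricSpace Y]
    (h : ∀ R : ℝ, 0 < R → ∃ c : ℕ, ∀ M : ℕ, ∃ (L : ℕ) (B : Y → ℕ → Finset (Σ _ : Y, ℕ)) (S : ℝ),
      1 ≤ L ∧ (∀ y k, L ≤ (B y k).card) ∧ (∀ y, (B y M).card ≤ c * L) ∧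
      (∀ y y' k, dist y y' ≤ R → B y k ⊆ B y' (k + 1)) ∧
      ∀ y, ∀ k < M, ∀ p ∈ B y k, dist p.1 y ≤ S) :
    PropertyA Y := by
  intro R hR ε hε
  obtain ⟨c, hc⟩ := h R hR
  -- The symmetric difference will have at most `(2 * c + 2) * L` elements and the intersection at
  -- least `(M - c) * L`.
  obtain ⟨M, hM⟩ := exists_nat_gt ((2 * c + 2) / ε + c)
  obtain ⟨L, B, S, hL, hB, hBM, hBB, hS⟩ := hc M
  let P : Y → Finset (Σ _ : ℕ, Σ _ : Y, ℕ) := fun y => (Finset.range M).sigma (B y)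
  -- The shift by `2` keeps the image away from `(y, 1)`.
  let e : (Σ _ : ℕ, Σ _ : Y, ℕ) → Y × ℕ := fun p => (p.2.1, Nat.pair p.1 p.2.2 + 2)
  have he : Function.Injective e := by
    rintro ⟨k, w, m⟩ ⟨k', w', m'⟩ hkk
    simp only [e, Prod.mk.injEq, add_left_inj, Nat.pair_eq_pair] at hkk
    obtain ⟨rfl, rfl, rfl⟩ := hkk
    rfl
  have hPsdiff : ∀ y y', dist y y' ≤ R → (P y \ P y').card ≤ c * L := fun y y' hyy' =>
    (card_sigma_range_sdiff_le (fun k => hBB y' y' k (by simpa using hR.le))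
      (fun k => hBB y y' k hyy')).trans (hBM y')
  have hPcard : ∀ y, M * L ≤ (P y).card := fun y => by
    rw [Finset.card_sigma]
    simpa using Finset.card_nsmul_le_sum (Finset.range M) (fun k => (B y k).card) L
      (fun k _ => hB y k)
  have hAsdiff : ∀ y y', dist y y' ≤ R →
      (insert (y, 1) ((P y).image e) \ insert (y', 1) ((P y').image e)).card ≤ c * L + 1 := by
    intro y y' hyy'
    have hsub : insert (y, 1) ((P y).image e) \ insert (y', 1) ((P y').image e) ⊆
        insert (y, 1) ((P y \ P y').image e) := by
      rw [Finset.image_sdiff _ _ he]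
      intro p hp
      simp only [Finset.mem_sdiff, Finset.mem_insert] at hp ⊢
      tauto
    refine (Finset.card_le_card hsub).trans ((Finset.card_insert_le _ _).trans ?_)
    exact Nat.succ_le_succ (Finset.card_image_le.trans (hPsdiff y y' hyy'))
  refine ⟨fun y => insert (y, 1) ((P y).image e), fun y => Finset.mem_insert_self _ _,
    fun y y' hyy' => ?_, 2 * max S 1, by positivity, fun y => ?_⟩
  · have h1 := hAsdiff y y' hyy'
    have h2 := hAsdiff y' y (by rwa [dist_comm])
    have h3 : (symmDiff (insert (y, 1) ((P y).image e))
        (insert (y', 1) ((P y').image e))).card ≤ 2 * (c * L + 1) := by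
      rw [symmDiff_def]
      exact (Finset.card_union_le _ _).trans (by omega)
    have h4 : M * L ≤ (insert (y, 1) ((P y).image e) ∩ insert (y', 1) ((P y').image e)).card
        + c * L := by
      have hsub : (P y ∩ P y').image e ⊆
          insert (y, 1) ((P y).image e) ∩ insert (y', 1) ((P y').image e) := by
        rw [Finset.image_inter _ _ he]
        exact Finset.inter_subset_inter (Finset.subset_insert _ _) (Finset.subset_insert _ _)
      have h5 := Finset.card_le_card hsub
      rw [Finset.card_image_of_injective _ he] at h5
      have h6 := Finset.card_sdiff_add_card_inter (P y) (P y')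
      have h7 := hPsdiff y y' hyy'
      have h8 := hPcard y
      omega
    have h3' : ((symmDiff (insert (y, 1) ((P y).image e))
        (insert (y', 1) ((P y').image e))).card : ℝ) ≤ 2 * (c * L + 1) := by exact_mod_cast h3
    have h4' : (M * L : ℝ) ≤
        ((insert (y, 1) ((P y).image e) ∩ insert (y', 1) ((P y').image e)).card : ℝ) + c * L := by
      exact_mod_cast h4
    have hL' : (1 : ℝ) ≤ L := by exact_mod_cast hL
    have hM' : 2 * (c : ℝ) + 2 < ε * (M - c) := by
      have := (div_lt_iff₀' hε).1 (lt_sub_iff_add_lt.2 hM)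
      linarith
    calc _ ≤ 2 * ((c : ℝ) * L + 1) := h3'
      _ ≤ (2 * c + 2) * L := by linarith
      _ < ε * (M - c) * L := by gcongr
      _ ≤ _ := by
        rw [mul_assoc]
        refine mul_le_mul_of_nonneg_left ?_ hε.le
        linarith
  · have hnear : ∀ p ∈ insert (y, 1) ((P y).image e), dist p.1 y ≤ max S 1 := by
      intro p hp
      rcases Finset.mem_insert.1 hp with rfl | hp
      · simp
      · obtain ⟨⟨k, w⟩, hkw, rfl⟩ := Finset.mem_image.1 hp
        obtain ⟨hk, hw⟩ := Finset.mem_sigma.1 hkw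
        exact (hS y k (Finset.mem_range.1 hk) w hw).trans (le_max_left _ _)
    intro p hp p' hp'
    have := dist_triangle_right p.1 p'.1 y
    have := hnear p hp
    have := hnear p' hp'
    linarith

/-! ### Property A of the target -/

theorem mainTheorem10 {X : Type*} {Y : Type*} [MetricSpace X] [MetricSpace Y]
    (hX : BoundedGeometry X) (hY : BoundedGeometry Y) (n : ℕ) (f : X → Y)
    (hf : CoarselyNToOne n f) (hsurj : CoarselySurjective f) (hA : PropertyA X) :
    PropertyA Y := by
  classical
  obtain ⟨Γ, s, hΓ, hfin⟩ := hX
  obtain ⟨R₀, -, hR₀⟩ := hsurj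
  obtain ⟨E, hE⟩ := hf.1.exists_dist_le s
  -- Balls of radius `R₀ + E` already contain images of points of `Γ`.
  have hdense : ∀ y, ∃ g ∈ Γ, dist (f g) y ≤ R₀ + E := fun y => by
    obtain ⟨x, hx⟩ := hR₀ y
    obtain ⟨g, hg, hxg⟩ := hΓ x
    refine ⟨g, hg, ?_⟩
    have h1 := hE x g hxg
    have h2 := dist_triangle y (f x) (f g)
    rw [dist_comm]
    linarith
  -- The preimage of a ball meets `Γ` in a finite set, being covered by `n` bounded sets.
  have hballfin : ∀ (y : Y) (r : ℝ), {x | x ∈ Γ ∧ dist (f x) y ≤ r}.Finite := fun y r => by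
    obtain ⟨C, hC⟩ := hf.exists_cover_preimage_closedBall r
    obtain ⟨A, hcov, hdiam⟩ := hC y
    obtain ⟨N, hN⟩ := hfin C
    refine (Set.finite_iUnion (f := fun i => Γ ∩ A i) fun i => ?_).subset fun x hx => ?_
    · rcases (A i).eq_empty_or_nonempty with h0 | ⟨a, ha⟩
      · simp [h0]
      · exact (Set.finite_of_encard_le_coe (hN a)).subset
          fun x hx => ⟨hx.1, hdiam i x hx.2 a ha⟩
    · obtain ⟨i, hi⟩ := hcov x hx.2
      exact Set.mem_iUnion.2 ⟨i, hx.1, hi⟩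
  refine PropertyA.of_nested_families fun R hR => ⟨3 * n, fun M => ?_⟩
  obtain ⟨C, hC⟩ := hf.exists_cover_preimage_closedBall (R₀ + E + M * R)
  obtain ⟨N, hN⟩ := hfin C
  have hN0 : (0 : ℝ) < N + 1 := by positivity
  obtain ⟨L, D, S, hL, hDge, hDle, hDnear, hDS⟩ :=
    hA.exists_normalized_family hY hf.1 C (δ := 1 / (N + 1)) (by positivity)
  let F : Y → ℕ → Finset X := fun y k => (hballfin y (R₀ + E + k * R)).toFinset
  have hF : ∀ y k x, x ∈ F y k ↔ x ∈ Γ ∧ dist (f x) y ≤ R₀ + E + k * R := fun y k x => by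
    simp [F]
  refine ⟨L, fun y k => (F y k).biUnion D, S + (R₀ + E + M * R), hL, fun y k => ?_, fun y => ?_,
    fun y y' k hyy' => ?_, fun y k hk p hp => ?_⟩
  · obtain ⟨g, hg, hgy⟩ := hdense y
    have hgF : g ∈ F y k := (hF y k g).2 ⟨hg, hgy.trans (le_add_of_nonneg_right (by positivity))⟩
    exact (hDge g).trans (Finset.card_le_card (Finset.subset_biUnion_of_mem D hgF))
  · obtain ⟨A, hcov, hdiam⟩ := hC y
    refine card_biUnion_le_of_cover (N := N) (δ := 1 / (N + 1)) (by positivity) ?_ hDle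
      (A := A) (fun x hx => hcov x ((hF y M x).1 hx).2) (fun i => ?_)
      (fun i x hx x' hx' => hDnear x x' (hdiam i x hx x' hx'))
    · rw [mul_one_div, div_le_one hN0]
      linarith
    · rcases ((F y M).filter (· ∈ A i)).eq_empty_or_nonempty with h0 | ⟨a, ha⟩
      · simp [h0]
      have hsub : (((F y M).filter (· ∈ A i) : Finset X) : Set X) ⊆
          Γ ∩ Metric.closedBall a C := fun x hx => by
        have hx' := Finset.mem_filter.1 (Finset.mem_coe.1 hx)
        exact ⟨((hF y M x).1 hx'.1).1, hdiam i x hx'.2 a (Finset.mem_filter.1 ha).2⟩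
      have h := (Set.encard_le_encard hsub).trans (hN a)
      rw [Set.encard_coe_eq_coe_finsetCard] at h
      exact_mod_cast h
  · refine Finset.biUnion_subset_biUnion_of_subset_left D fun x hx => ?_
    rw [hF] at hx ⊢
    refine ⟨hx.1, ?_⟩
    have h1 := dist_triangle (f x) y y'
    have h2 := hx.2
    push_cast
    linarith
  · obtain ⟨x, hx, hpx⟩ := Finset.mem_biUnion.1 hp
    have h1 := hDS x p hpx
    have h2 := ((hF y k x).1 hx).2
    have h3 : (k : ℝ) * R ≤ M * R := by
      have : (k : ℝ) ≤ M := by exact_mod_cast hk.le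
      gcongr
    have h4 := dist_triangle p.1 (f x) y
    linarith
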